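/- All graphs are finite and simple. A graph is called Eulerian if it is connected and contains an Eulerian circuit, i.e. a closed walk with at least three edges that traverses every edge of the graph exactly once. For a graph $G$ on a vertex set $V$, let $N_{edit}(G)$ be the smallest number $k \ge 0$ of successive edits, each of them the addition or the removal of a single edge, that convert $G$ into an Eulerian graph on $V$. If some Eulerian graph on $V$ arises from $G$ by adding edges, $G$ is called Eulerian extendable, and $N_{ext}(G)$ is the minimum number of edges that must be added. If some Eulerian graph on $V$ arises from $G$ by removing edges, $G$ is called Eulerian reducible, and $N_{red}(G)$ is the minimum number of edges that must be removed. **Theorem.** For every $\eta > 0$ and every $r > 0$ there is an integer $n_0 = n_0(\eta, r) \ge 1$ such that the following holds for all $n \ge n_0$ and all $p$ with $$\frac{(\log n)^2}{\sqrt n} \le p \le 1 - \frac{(\log n)^2}{\sqrt n}.$$ Let $H = G(n,p)$ be the random graph on $n$ vertices in which each of the $\binom n2$ possible edges is present independently with probability $p$. Then, with probability at least $1 - n^{-r}$, the graph $H$ is both Eulerian extendable and Eulerian reducible, and all three numbers $N_{edit}(H)$, $N_{ext}(H)$ and $N_{red}(H)$ lie in the interval $$\left[\frac n4 - n^{\frac12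 + \eta},\ \frac n4 + n^{\frac12+\eta}\right].$$ -/

import Mathlib

namespace SimpleGraph

variable {V : Type*}

open Classical in
/-- A graph is Eulerian if it is connected and has an Eulerian circuit: a closed walk with at
least three steps that traverses every edge exactly once. -/
def IsEulerianGraph (G : SimpleGraph V) : Prop :=
  G.Connected ∧ ∃ (v : V) (w : G.Walk v v), 3 ≤ w.length ∧ w.IsEulerian

/-- `G'` is obtained from `G` by the addition or the removal of a single edge. -/
def IsSingleEdit (G G' : SimpleGraph V) : Prop :=
  ∃ e : Sym2 V,
    (e ∉ G.edgeSet ∧ G'.edgeSet = insert e G.edgeSet) ∨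
    (e ∈ G.edgeSet ∧ G'.edgeSet = G.edgeSet \ {e})

/-- `IsEditGraph G k G'` : the graph `G'` is a `k`-edit graph of `G`, that is, it arises from `G`
by `k` successive single-edge edits. -/
inductive IsEditGraph (G : SimpleGraph V) : ℕ → SimpleGraph V → Prop
  | zero : IsEditGraph G 0 G
  | succ {k : ℕ} {G' G'' : SimpleGraph V} :
      IsEditGraph G k G' → IsSingleEdit G' G'' → IsEditGraph G (k + 1) G''

/-- The numbers of edits by which `G` can be converted into an Eulerian graph. -/
def eulerianEditSet (G : SimpleGraph V) : Set ℕ :=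
  {k | ∃ G' : SimpleGraph V, G.IsEditGraph k G' ∧ G'.IsEulerianGraph}

/-- The numbers of edges by whose addition `G` can be converted into an Eulerian graph. -/
def eulerianExtSet (G : SimpleGraph V) : Set ℕ :=
  {k | ∃ G' : SimpleGraph V,
    G ≤ G' ∧ (G'.edgeSet \ G.edgeSet).encard = k ∧ G'.IsEulerianGraph}

/-- The numbers of edges by whose removal `G` can be converted into an Eulerian graph. (By
definition an Eulerian graph has at least three edges, so the result has an edge.) -/
def eulerianRedSet (G : SimpleGraph V) : Set ℕ :=
  {k | ∃ G' : SimpleGraph V,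
    G' ≤ G ∧ (G.edgeSet \ G'.edgeSet).encard = k ∧ G'.IsEulerianGraph}

/-- `G` can be converted into an Eulerian graph by finitely many edits. -/
def EulerianEditable (G : SimpleGraph V) : Prop := G.eulerianEditSet.Nonempty

/-- `G` can be converted into an Eulerian graph by adding finitely many edges. -/
def EulerianExtendable (G : SimpleGraph V) : Prop := G.eulerianExtSet.Nonempty

/-- `G` can be converted into an Eulerian graph by removing finitely many edges. -/
def EulerianReducible (G : SimpleGraph V) : Prop := G.eulerianRedSet.Nonempty

/-- The Eulerian edit number (meaningful if `G` is `EulerianEditable`). -/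
noncomputable def eulerianEditNumber (G : SimpleGraph V) : ℕ := sInf G.eulerianEditSet

/-- The Eulerian extension number (meaningful if `G` is `EulerianExtendable`). -/
noncomputable def eulerianExtNumber (G : SimpleGraph V) : ℕ := sInf G.eulerianExtSet

/-- The Eulerian reduction number (meaningful if `G` is `EulerianReducible`). -/
noncomputable def eulerianRedNumber (G : SimpleGraph V) : ℕ := sInf G.eulerianRedSet

end SimpleGraph

/-! One edit changes the degree parity of two vertices, and an Eulerian graph has no odd vertex. So
each of the three numbers is at least half the size of the set `T` of odd vertices.

Conversely, let `J` have odd set exactly `T`, inside the complement for additions, inside the graph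
for removals. Adding or removing `J` makes all degrees even, and by Euler's theorem only
connectedness remains. For `J`, take a maximal matching within `T` and pair the unmatched vertices,
an independent set `U`, by paths of length two (`exists_le_oddVerts_eq`). This costs at most `(#T +
#U) / 2` edges, and `#U < 2k` with `k = ⌈√n⌉` if any two disjoint `k`-sets have an edge between
them. `IsRobust` collects what is needed of the graph and its complement. It holds with high
probability by union bounds; the bounds on `p` make `n p²` and `n (1 - p)²` at least `(log n)^4`,
which secures common neighbours.

It remains to see that `#T` is near `n / 2`. The parities are dependent, but the product of the
signs `(-1) ^ deg v` over `S` has expectation of modulus at most `|1 - 2p| ^ (#S (n - #S))`,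
negligible unless `S` is nearly empty or nearly everything. So the moment generating function of the
sum of signs is at most six times the bound `exp (n t² / 2)` for independent signs
(`integral_exp_sum_neg_one_pow_le`), and Chernoff's argument applies. -/

namespace SimpleGraph

/-! ### Euler's theorem, parity under edits, and subgraphs with prescribed odd vertices -/

section Deterministic

open Finset
open scoped Classical

variable {V : Type*} [Fintype V] {G H J : SimpleGraph V}

/-- A finite graph with a trail from `u` to a different vertex and with even degree at `u` has an
edge at `u` outside this trail. -/
theorem exists_adj_notMem_edges_of_isTrail {u v : V} {w : G.Walk u v} (hw : w.IsTrail)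
    (huv : u ≠ v) (he : Even (G.degree u)) : ∃ y, G.Adj u y ∧ s(u, y) ∉ w.edges := by
  by_contra! hall
  -- An open trail uses an odd number of edges at its end `u`; these cannot be all edges at `u`.
  have hodd : ¬ Even (w.edges.countP fun e => u ∈ e) := by
    rw [hw.even_countP_edges_iff]
    simp [huv]
  apply hodd
  rw [← Multiset.coe_countP, Multiset.countP_eq_card_filter]
  change Even (#(hw.edgesFinset.filter (u ∈ ·)))
  rw [← card_incidenceFinset_eq_degree, incidenceFinset_eq_filter] at he
  convert he using 2
  ext e
  simp only [mem_filter, mem_edgeFinset]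
  constructor
  · rintro ⟨h1, h2⟩
    exact ⟨w.edges_subset_edgeSet h1, h2⟩
  · rintro ⟨h1, h2⟩
    obtain ⟨y, rfl⟩ := Sym2.mem_iff_exists.1 h2
    exact ⟨hall y h1, h2⟩

/-- **Euler's theorem**: a connected finite graph with even degrees has an Eulerian circuit. -/
theorem Connected.exists_isEulerian (hG : G.Connected) (he : ∀ x, Even (G.degree x)) :
    ∃ (v : V) (w : G.Walk v v), w.IsEulerian := by
  obtain ⟨v₀⟩ := hG.nonempty
  -- A longest trail: it is closed by parity, and an edge it misses would give a longer one.
  let S : Set ℕ := {m | ∃ (u v : V) (w : G.Walk u v), w.IsTrail ∧ w.length = m}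
  have hne : S.Nonempty := ⟨0, v₀, v₀, .nil, by simp, rfl⟩
  have hbdd : BddAbove S := by
    refine ⟨#G.edgeFinset, ?_⟩
    rintro m ⟨u, v, w, hw, rfl⟩
    exact hw.length_le_card_edgeFinset
  obtain ⟨u, v, w, hw, hlen⟩ := Nat.sSup_mem hne hbdd
  have hmax : ∀ {x y : V} (w' : G.Walk x y), w'.IsTrail → w'.length ≤ w.length := by
    intro x y w' hw'
    rw [hlen]
    exact le_csSup hbdd ⟨x, y, w', hw', rfl⟩
  obtain rfl | huv := eq_or_ne u v
  swap
  · obtain ⟨y, hy, hyw⟩ := exists_adj_notMem_edges_of_isTrail hw huv (he u)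
    have := hmax (.cons hy.symm w) ((Walk.isTrail_cons _ _).2 ⟨hw, by rwa [Sym2.eq_swap]⟩)
    simp at this
  refine ⟨u, w, hw.isEulerian_of_forall_mem ?_⟩
  by_contra! hcov
  -- By connectedness some missed edge touches the trail; rotating the trail to start there allows
  -- prepending it.
  obtain ⟨x, y, hxy, hx, hxyw⟩ : ∃ x y, G.Adj x y ∧ x ∈ w.support ∧ s(x, y) ∉ w.edges := by
    obtain ⟨e, heG, hew⟩ := hcov
    induction e with
    | _ a b =>
    by_cases ha : a ∈ w.support
    · exact ⟨a, b, heG, ha, hew⟩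
    obtain ⟨q⟩ := hG.preconnected u a
    obtain ⟨d, -, hd1, hd2⟩ := q.exists_boundary_dart {z | z ∈ w.support} (by simp) ha
    exact ⟨d.fst, d.snd, d.adj, hd1, fun h => hd2 (w.snd_mem_support_of_mem_edges h)⟩
  have := hmax (.cons hxy.symm (w.rotate x hx)) ((Walk.isTrail_cons _ _).2
    ⟨hw.rotate hx, by rwa [Sym2.eq_swap, (w.rotate_edges x hx).mem_iff]⟩)
  simp at this

/-- Four vertices suffice for the length condition: a connected graph on them has at least three
edges. -/
theorem isEulerianGraph_of_even_degree (hV : 4 ≤ Fintype.card V) (hG : G.Connected)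
    (he : ∀ x, Even (G.degree x)) : G.IsEulerianGraph := by
  obtain ⟨v, w, hw⟩ := hG.exists_isEulerian he
  refine ⟨hG, v, w, ?_, ?_⟩
  · have h1 := hG.card_vert_le_card_edgeSet_add_one
    have h2 : w.length = Nat.card G.edgeSet := by
      rw [← w.length_edges, Nat.card_eq_fintype_card, ← edgeFinset_card, ← hw.edgesFinset_eq]
      rfl
    rw [Nat.card_eq_fintype_card] at h1
    omega
  · convert hw

/-- The set of vertices of odd degree. -/
noncomputable def oddVerts (G : SimpleGraph V) : Finset V := {v | Odd (G.degree v)}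

@[simp]
theorem mem_oddVerts {v : V} : v ∈ G.oddVerts ↔ Odd (G.degree v) := by simp [oddVerts]

theorem even_card_oddVerts : Even #G.oddVerts := by
  convert G.even_card_odd_degree_vertices using 2
  ext; simp

theorem IsEulerianGraph.oddVerts_eq_empty (hG : G.IsEulerianGraph) : G.oddVerts = ∅ := by
  obtain ⟨-, v, w, -, hw⟩ := hG
  ext x
  have hw' : w.IsEulerian := by convert hw
  have := hw'.even_degree_iff (x := x)
  simp at this
  simp [this]

theorem degree_of_eq_sup {K : SimpleGraph V} (hK : K = G ⊔ H) (h : Disjoint G H) (v : V) :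
    K.degree v = G.degree v + H.degree v := by
  rw [← card_neighborFinset_eq_degree, ← card_neighborFinset_eq_degree,
    ← card_neighborFinset_eq_degree, ← card_union_of_disjoint]
  · congr 1; ext; simp [hK]
  · rw [Finset.disjoint_left]
    intro x hx hx'
    rw [mem_neighborFinset] at hx hx'
    exact (disjoint_left.1 h) _ _ hx hx'

theorem degree_edge {a b : V} (hab : a ≠ b) (v : V) :
    (edge a b).degree v = if v = a ∨ v = b then 1 else 0 := by
  rw [← card_neighborFinset_eq_degree]
  split_ifs with h
  · rw [card_eq_one]
    obtain rfl | rfl := h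
    · exact ⟨b, by ext; simp [edge_adj]; grind⟩
    · exact ⟨a, by ext; simp [edge_adj]; grind⟩
  · rw [card_eq_zero]
    ext; simp [edge_adj]; grind

theorem degree_of_eq_sup_edge {K : SimpleGraph V} {a b : V} (hK : K = G ⊔ edge a b) (hab : a ≠ b)
    (hG : ¬ G.Adj a b) (v : V) : K.degree v = G.degree v + if v = a ∨ v = b then 1 else 0 := by
  rw [degree_of_eq_sup hK ((disjoint_edge G).2 hG)]
  congr 1
  convert degree_edge hab v

theorem ncard_edgeSet_sup_edge_le {a b : V} :
    (G ⊔ edge a b).edgeSet.ncard ≤ G.edgeSet.ncard + 1 := by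
  rw [edgeSet_sup]
  refine (Set.ncard_union_le _ _).trans ?_
  gcongr
  refine (Set.ncard_le_ncard edgeSet_edge_subset).trans ?_
  simp

theorem IsSingleEdit.card_oddVerts_le {G' : SimpleGraph V} (h : G.IsSingleEdit G') :
    #G.oddVerts ≤ #G'.oddVerts + 2 := by
  -- Removing an edge is adding it read backwards, so both inequalities are proved for an added
  -- edge.
  have key : ∀ {A B : SimpleGraph V} {e : Sym2 V}, e ∉ A.edgeSet → B.edgeSet = insert e A.edgeSet →
      #A.oddVerts ≤ #B.oddVerts + 2 ∧ #B.oddVerts ≤ #A.oddVerts + 2 := by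
    intro A B e heA hB
    induction e with
    | _ a b =>
    have hab : a ≠ b := by
      have : s(a, b) ∈ B.edgeSet := by rw [hB]; simp
      exact B.ne_of_adj this
    have hBA : B = A ⊔ edge a b := by
      rw [← edgeSet_inj, edgeSet_sup, edgeSet_edge_of_ne hab, hB, Set.union_singleton]
    have hdeg := degree_of_eq_sup_edge hBA hab heA
    have h2 : #({a, b} : Finset V) ≤ 2 := card_le_two
    constructor
    · refine (card_le_card (t := B.oddVerts ∪ {a, b}) ?_).trans ((card_union_le _ _).trans (by gcongr))
      intro v
      have := hdeg v
      simp only [mem_oddVerts, mem_union, mem_insert, Finset.mem_singleton, this]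
      split_ifs <;> grind
    · refine (card_le_card (t := A.oddVerts ∪ {a, b}) ?_).trans ((card_union_le _ _).trans (by gcongr))
      intro v
      have := hdeg v
      simp only [mem_oddVerts, mem_union, mem_insert, Finset.mem_singleton, this]
      split_ifs <;> grind
  obtain ⟨e, ⟨h1, h2⟩ | ⟨h1, h2⟩⟩ := h
  · exact (key h1 h2).1
  · refine (key (A := G') (B := G) (e := e) ?_ ?_).2
    · simp [h2]
    · simp [h2, Set.insert_eq_of_mem h1]

theorem IsEditGraph.card_oddVerts_le {G' : SimpleGraph V} {k : ℕ} (h : G.IsEditGraph k G') :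
    #G.oddVerts ≤ #G'.oddVerts + 2 * k := by
  induction h with
  | zero => simp
  | succ _ h2 ih =>
    have := h2.card_oddVerts_le
    omega

/-- An edge of `G'` outside `G` is taken as the last one added; hence `G'` varies in the induction
while `G` is fixed. -/
theorem isEditGraph_of_le {k : ℕ} : ∀ {G' : SimpleGraph V}, G ≤ G' →
    (G'.edgeSet \ G.edgeSet).ncard = k → G.IsEditGraph k G' := by
  induction k with
  | zero =>
    intro G' hle h
    rw [Set.ncard_eq_zero, Set.sdiff_eq_empty, edgeSet_subset_edgeSet] at h
    rw [le_antisymm h hle]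
    exact .zero
  | succ k ih =>
    intro G' hle h
    obtain ⟨e, he⟩ : (G'.edgeSet \ G.edgeSet).Nonempty := by
      rw [← Set.ncard_pos]; omega
    refine .succ (G' := G'.deleteEdges {e}) (ih ?_ ?_) ⟨e, .inl ⟨?_, ?_⟩⟩
    · rw [← edgeSet_subset_edgeSet, edgeSet_deleteEdges]
      intro f hf
      refine ⟨edgeSet_subset_edgeSet.2 hle hf, ?_⟩
      rintro rfl
      exact he.2 hf
    · rw [edgeSet_deleteEdges, Set.sdiff_sdiff_comm, Set.ncard_sdiff_singleton_of_mem he, h]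
      rfl
    · simp
    · simp [Set.insert_eq_of_mem he.1]

theorem isEditGraph_of_ge {k : ℕ} : ∀ {G' : SimpleGraph V}, G' ≤ G →
    (G.edgeSet \ G'.edgeSet).ncard = k → G.IsEditGraph k G' := by
  induction k with
  | zero =>
    intro G' hle h
    rw [Set.ncard_eq_zero, Set.sdiff_eq_empty, edgeSet_subset_edgeSet] at h
    rw [le_antisymm h hle]
    exact .zero
  | succ k ih =>
    intro G' hle h
    obtain ⟨e, he⟩ : (G.edgeSet \ G'.edgeSet).Nonempty := by
      rw [← Set.ncard_pos]; omega
    have hes : (G' ⊔ fromEdgeSet {e}).edgeSet = insert e G'.edgeSet := by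
      rw [edgeSet_sup, edgeSet_fromEdgeSet, Set.union_comm, sdiff_eq_left.2, Set.singleton_union]
      simpa using G.not_isDiag_of_mem_edgeSet he.1
    refine .succ (G' := G' ⊔ fromEdgeSet {e}) (ih ?_ ?_) ⟨e, .inr ⟨?_, ?_⟩⟩
    · rw [← edgeSet_subset_edgeSet, hes]
      exact Set.insert_subset he.1 (edgeSet_subset_edgeSet.2 hle)
    · have : G.edgeSet \ (G' ⊔ fromEdgeSet {e}).edgeSet = (G.edgeSet \ G'.edgeSet) \ {e} := by
        rw [hes]; ext; simp; tauto
      rw [this, Set.ncard_sdiff_singleton_of_mem he, h]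
      rfl
    · simp [hes]
    · rw [hes]
      ext f
      simp only [Set.mem_sdiff, Set.mem_insert_iff, Set.mem_singleton_iff]
      have := he.2
      grind

theorem eulerianExtSet_subset_eulerianEditSet : G.eulerianExtSet ⊆ G.eulerianEditSet := by
  rintro k ⟨G', hle, hk, hG'⟩
  exact ⟨G', isEditGraph_of_le hle (by rw [Set.ncard, hk]; simp), hG'⟩

theorem eulerianRedSet_subset_eulerianEditSet : G.eulerianRedSet ⊆ G.eulerianEditSet := by
  rintro k ⟨G', hle, hk, hG'⟩
  exact ⟨G', isEditGraph_of_ge hle (by rw [Set.ncard, hk]; simp), hG'⟩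

theorem card_oddVerts_le_of_mem_eulerianEditSet {k : ℕ} (hk : k ∈ G.eulerianEditSet) :
    #G.oddVerts ≤ 2 * k := by
  obtain ⟨G', h, hG'⟩ := hk
  simpa [hG'.oddVerts_eq_empty] using h.card_oddVerts_le

/-- If every two distinct vertices of `G` have a common neighbour, then every independent set `T` of
even size is the set of odd-degree vertices of a subgraph with at most `#T` edges. -/
theorem exists_le_oddVerts_eq_of_isIndepSet
    (hcn : ∀ u v, u ≠ v → ∃ w, G.Adj u w ∧ G.Adj v w) (m : ℕ) :
    ∀ T : Finset V, #T = 2 * m → G.IsIndepSet T →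
      ∃ J ≤ G, J.oddVerts = T ∧ J.edgeSet.ncard ≤ #T ∧ (∀ x y, J.Adj x y → x ∈ T ∨ y ∈ T) ∧
        ∀ u ∈ T, J.degree u = 1 := by
  induction m with
  | zero =>
    intro T hT hind
    rw [mul_zero, card_eq_zero] at hT
    subst hT
    refine ⟨⊥, bot_le, ?_, by simp, by simp, by simp⟩
    ext; simp
  | succ m ih =>
    intro T hT hind
    obtain ⟨u, hu⟩ : T.Nonempty := by rw [← card_pos]; omega
    obtain ⟨v, hv⟩ : (T.erase u).Nonempty := by rw [← card_pos, card_erase_of_mem hu]; omega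
    have huv : u ≠ v := (ne_of_mem_erase hv).symm
    have hv' : v ∈ T := mem_of_mem_erase hv
    set T' := (T.erase u).erase v with hT'
    have hmem : ∀ x, x ∈ T ↔ x ∈ T' ∨ x = u ∨ x = v := by
      intro x; simp only [hT', mem_erase]; grind
    have huT' : u ∉ T' := by simp [hT']
    have hvT' : v ∉ T' := by simp [hT']
    have hcard : #T' = 2 * m := by
      rw [hT', card_erase_of_mem hv, card_erase_of_mem hu]; omega
    have hsub : (T' : Set V) ⊆ T := fun x hx => (hmem x).2 (.inl hx)
    obtain ⟨J, hJG, hJodd, hJcard, hJmem, hJdeg⟩ := ih T' hcard (hind.mono hsub)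
    -- The path `u w v` is added to `J`; independence of `T` puts `w` outside `T`.
    obtain ⟨w, huw, hvw⟩ := hcn u v huv
    have hindep : ∀ x ∈ T, ∀ y ∈ T, ¬ G.Adj x y := by
      intro x hx y hy hxy
      exact hind hx hy (G.ne_of_adj hxy) hxy
    have hwT : w ∉ T := fun h => hindep u hu w h huw
    have hwT' : w ∉ T' := fun h => hwT ((hmem w).2 (.inl h))
    -- Every edge of `J` meets `T'`, which contains none of `u`, `v`, `w`. So both edges are new and
    -- degrees add.
    have h1 : ¬ J.Adj u w := fun h => by
      rcases hJmem _ _ h with h | h <;> contradiction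
    have h2 : ¬ (J ⊔ edge u w).Adj v w := by
      rw [sup_adj, edge_adj]
      rintro (h | h)
      · rcases hJmem _ _ h with h | h <;> contradiction
      · grind
    have hJu : J.degree u = 0 := by
      rw [← card_neighborFinset_eq_degree, card_eq_zero]
      refine eq_empty_of_forall_notMem fun y hy => ?_
      rw [mem_neighborFinset] at hy
      exact hindep u hu y (hsub ((hJmem _ _ hy).resolve_left huT')) (hJG hy)
    have hJv : J.degree v = 0 := by
      rw [← card_neighborFinset_eq_degree, card_eq_zero]
      refine eq_empty_of_forall_notMem fun y hy => ?_
      rw [mem_neighborFinset] at hy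
      exact hindep v hv' y (hsub ((hJmem _ _ hy).resolve_left hvT')) (hJG hy)
    obtain ⟨K, hK⟩ : ∃ K, K = J ⊔ edge u w ⊔ edge v w := ⟨_, rfl⟩
    have hdeg : ∀ x, K.degree x =
        J.degree x + (if x = u ∨ x = w then 1 else 0) + (if x = v ∨ x = w then 1 else 0) := by
      intro x
      rw [degree_of_eq_sup_edge hK hvw.ne h2]
      congr 1
      convert degree_of_eq_sup_edge rfl huw.ne h1 x
    refine ⟨K, ?_, ?_, ?_, ?_, ?_⟩
    · rw [hK]
      exact sup_le (sup_le hJG ((edge_le_iff G).2 (.inr huw))) ((edge_le_iff G).2 (.inr hvw))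
    · ext x
      have hx : Odd (J.degree x) ↔ x ∈ T' := by rw [← hJodd, mem_oddVerts]
      have hwu := huw.ne
      have hwv := hvw.ne
      rw [mem_oddVerts, hdeg, hmem, ← hx]
      by_cases hxu : x = u
      · subst hxu
        simp [hJu, hwu, huv]
      by_cases hxv : x = v
      · subst hxv
        simp [hJv, hwv, hxu]
      by_cases hxw : x = w
      · subst hxw
        simp [hxu, hxv, add_assoc, Nat.odd_add]
      · simp [hxu, hxv, hxw]
    · have := ncard_edgeSet_sup_edge_le (G := J ⊔ edge u w) (a := v) (b := w)
      have := ncard_edgeSet_sup_edge_le (G := J) (a := u) (b := w)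
      rw [hK]
      omega
    · intro x y
      simp only [hK, sup_adj, edge_adj, hmem]
      have := hJmem x y
      grind
    · intro x hx
      have hxw : x ≠ w := by rintro rfl; exact hwT hx
      rw [hdeg]
      rcases (hmem x).1 hx with h | rfl | rfl
      · have hxu : x ≠ u := by rintro rfl; exact huT' h
        have hxv : x ≠ v := by rintro rfl; exact hvT' h
        simp [hxu, hxv, hxw, hJdeg x h]
      · simp [hJu, hxw, huv]
      · simp [hJv, hxw, huv.symm]

/-- If every two distinct vertices of `G` have a common neighbour, then every set `T` of even size
is the set of odd-degree vertices of a subgraph `J`, which arises from a maximal matching of `G[T]`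
by treating the set `U` of unmatched vertices as in `exists_le_oddVerts_eq_of_isIndepSet`. -/
theorem exists_le_oddVerts_eq (hcn : ∀ u v, u ≠ v → ∃ w, G.Adj u w ∧ G.Adj v w) (m : ℕ) :
    ∀ T : Finset V, #T = 2 * m →
      ∃ J ≤ G, ∃ U ⊆ T, J.oddVerts = T ∧ 2 * J.edgeSet.ncard ≤ #T + #U ∧ G.IsIndepSet U ∧
        (∀ u ∈ U, J.degree u = 1) ∧ (∀ x y, x ∉ U → y ∉ U → J.Adj x y → x ∈ T) ∧
        ∀ x, x ∉ U → #{y | y ∉ U ∧ J.Adj x y} ≤ 1 := by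
  induction m with
  | zero =>
    intro T hT
    rw [mul_zero, card_eq_zero] at hT
    subst hT
    refine ⟨⊥, bot_le, ∅, by simp, ?_, by simp, by simp, by simp, by simp, by simp⟩
    ext; simp
  | succ m ih =>
    intro T hT
    -- If `T` is independent, the matching is complete and `U = T`. Otherwise an edge `a b` within
    -- `T` joins the matching and `T` loses two vertices.
    by_cases hind : G.IsIndepSet T
    · obtain ⟨J, hJG, hJodd, hJcard, hJmem, hJdeg⟩ :=
        exists_le_oddVerts_eq_of_isIndepSet hcn (m + 1) T hT hind
      refine ⟨J, hJG, T, subset_rfl, hJodd, by omega, hind, hJdeg, ?_, ?_⟩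
      · intro x y hx hy h
        exact ((hJmem _ _ h).resolve_right hy)
      · intro x hx
        rw [filter_false_of_mem]
        · simp
        · rintro y - ⟨hy, h⟩
          rcases hJmem _ _ h with h | h <;> contradiction
    · obtain ⟨a, ha, b, hb, hab, hGab⟩ : ∃ a ∈ T, ∃ b ∈ T, a ≠ b ∧ G.Adj a b := by
        simpa [IsIndepSet, Set.Pairwise] using hind
      have hb' : b ∈ T.erase a := mem_erase.2 ⟨hab.symm, hb⟩
      set T' := (T.erase a).erase b with hT'
      have hmem : ∀ x, x ∈ T ↔ x ∈ T' ∨ x = a ∨ x = b := by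
        intro x; simp only [hT', mem_erase]; grind
      have haT' : a ∉ T' := by simp [hT']
      have hbT' : b ∉ T' := by simp [hT']
      have hcard : #T' = 2 * m := by
        rw [hT', card_erase_of_mem hb', card_erase_of_mem ha]; omega
      obtain ⟨J, hJG, U, hUT, hJodd, hJcard, hU, hJdeg, hJT, hJone⟩ := ih T' hcard
      have haU : a ∉ U := fun h => haT' (hUT h)
      have hbU : b ∉ U := fun h => hbT' (hUT h)
      have hJab : ¬ J.Adj a b := fun h => haT' (hJT a b haU hbU h)
      obtain ⟨K, hK⟩ : ∃ K, K = J ⊔ edge a b := ⟨_, rfl⟩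
      have hdeg := degree_of_eq_sup_edge hK hab hJab
      refine ⟨K, hK.le.trans <| sup_le hJG ((edge_le_iff G).2 (.inr hGab)), U,
        hUT.trans fun x hx => (hmem x).2 (.inl hx), ?_, ?_, hU, ?_, ?_, ?_⟩
      · ext x
        have hx : Odd (J.degree x) ↔ x ∈ T' := by rw [← hJodd, mem_oddVerts]
        rw [mem_oddVerts, hdeg, hmem, ← hx]
        by_cases hxab : x = a ∨ x = b
        · have : ¬ Odd (J.degree x) := by
            rw [hx]; rcases hxab with rfl | rfl <;> assumption
          simp only [hxab, if_true, or_true, iff_true]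
          grind
        · simp [hxab]
      · have := ncard_edgeSet_sup_edge_le (G := J) (a := a) (b := b)
        rw [hK]
        omega
      · intro u hu
        have hua : u ≠ a := by rintro rfl; exact haU hu
        have hub : u ≠ b := by rintro rfl; exact hbU hu
        simp [hdeg, hua, hub, hJdeg u hu]
      · intro x y hx hy
        rw [hK, sup_adj, edge_adj, hmem]
        have := hJT x y hx hy
        grind
      · intro x hx
        by_cases hxab : x = a ∨ x = b
        · rw [card_le_one]
          have hnone : ∀ y, y ∉ U → ¬ J.Adj x y := by
            intro y hy h
            have := hJT x y hx hy h
            grind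
          simp only [mem_filter, mem_univ, true_and, hK, sup_adj, edge_adj]
          grind
        · convert hJone x hx using 4 with y
          rw [hK, sup_adj, edge_adj]
          grind

end Deterministic

/-! ### Robust graphs and the deterministic bounds -/

section Robust

open Finset
open scoped Classical

variable {V : Type*} [Fintype V] {G J : SimpleGraph V}

/-- `G` has an edge between any two disjoint sets of vertices of sizes `a` and `b`. -/
def HoleFree (G : SimpleGraph V) (a b : ℕ) : Prop :=
  ∀ A B : Finset V, Disjoint A B → #A = a → #B = b → ∃ x ∈ A, ∃ y ∈ B, G.Adj x y

/-- Every two distinct vertices of `G` have a common neighbour. -/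
def HasCommonNeighbors (G : SimpleGraph V) : Prop :=
  ∀ u v, u ≠ v → ∃ w, G.Adj u w ∧ G.Adj v w

/-- A vertex of degree below `d` together with its non-neighbours forms a hole. Thus one union
bound, that for holes, also yields the minimum degree. -/
theorem HoleFree.le_degree {d : ℕ} (h : G.HoleFree 1 (Fintype.card V - d)) (x : V) :
    d ≤ G.degree x := by
  by_contra! hlt
  have h1 : Fintype.card V - d ≤ #(univ \ insert x (G.neighborFinset x)) := by
    rw [card_univ_sdiff]
    have := card_insert_le x (G.neighborFinset x)
    rw [card_neighborFinset_eq_degree] at this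
    omega
  obtain ⟨B, hB, hBcard⟩ := exists_subset_card_eq h1
  have hBmem : ∀ y ∈ B, y ≠ x ∧ ¬ G.Adj x y := by
    intro y hy
    simpa using hB hy
  obtain ⟨x', hx', y, hy, hadj⟩ := h {x} B (by
    rw [disjoint_singleton_left]
    exact fun hx => (hBmem x hx).1 rfl) (card_singleton x) hBcard
  rw [Finset.mem_singleton] at hx'
  subst hx'
  exact (hBmem y hy).2 hadj

omit [Fintype V] in
-- An independent set of size `2k` would contain two disjoint `k`-sets without an edge between them.
theorem HoleFree.card_lt_of_isIndepSet {k : ℕ} (h : G.HoleFree k k) {U : Finset V}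
    (hU : G.IsIndepSet U) : #U < 2 * k := by
  by_contra! hle
  obtain ⟨A, hA, hAk⟩ := exists_subset_card_eq (s := U) (n := k) (by omega)
  obtain ⟨B, hB, hBk⟩ := exists_subset_card_eq (s := U \ A) (n := k) (by
    rw [card_sdiff_of_subset hA]; omega)
  obtain ⟨x, hx, y, hy, hxy⟩ := h A B (disjoint_sdiff.mono_right hB) hAk hBk
  exact hU (hA hx) (mem_sdiff.1 (hB hy)).1 hxy.ne hxy

omit [Fintype V] in
theorem HasCommonNeighbors.connected [Nonempty V] (h : G.HasCommonNeighbors) : G.Connected := by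
  refine ⟨fun u v => ?_⟩
  obtain rfl | huv := eq_or_ne u v
  · exact .rfl
  · obtain ⟨w, hu, hv⟩ := h u v huv
    exact hu.reachable.trans hv.symm.reachable

/-- Outside `U`, `J` is a matching and `#U < 2k`, so each vertex there keeps at least `2k`
neighbours outside `U`. Two such neighbourhoods either meet or are joined by an edge that survives.
A vertex of `U` loses one edge, and its remaining neighbours lie outside `U`. -/
theorem HoleFree.connected_sdiff [Nonempty V] {k : ℕ} (h : G.HoleFree k k)
    (hdeg : ∀ x, 4 * k + 2 ≤ G.degree x) {U : Finset V} (hU : G.IsIndepSet U)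
    (hJU : ∀ u ∈ U, J.degree u = 1) (hJone : ∀ x, x ∉ U → #{y | y ∉ U ∧ J.Adj x y} ≤ 1) :
    (G \ J).Connected := by
  obtain ⟨K, hK⟩ : ∃ K, K = G \ J := ⟨_, rfl⟩
  have hKadj : ∀ x y, K.Adj x y ↔ G.Adj x y ∧ ¬ J.Adj x y := fun x y => by rw [hK, sdiff_adj]
  rw [← hK]
  have hUcard := h.card_lt_of_isIndepSet hU
  have hlarge : ∀ x, x ∉ U → 2 * k ≤ #{y | y ∉ U ∧ K.Adj x y} := by
    intro x hx
    have hsub : G.neighborFinset x ⊆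
        ({y | y ∉ U ∧ K.Adj x y} : Finset V) ∪ U ∪
        ({y | y ∉ U ∧ J.Adj x y} : Finset V) := by
      intro y hy
      simp only [mem_neighborFinset, mem_union, mem_filter, mem_univ, true_and, hKadj] at hy ⊢
      tauto
    have h1 := card_le_card hsub
    rw [card_neighborFinset_eq_degree] at h1
    have h2 := card_union_le (({y | y ∉ U ∧ K.Adj x y} : Finset V) ∪ U)
      {y | y ∉ U ∧ J.Adj x y}
    have h3 := card_union_le ({y | y ∉ U ∧ K.Adj x y} : Finset V) U
    have h4 := hJone x hx
    have h5 := hdeg x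
    omega
  have hout : ∀ x y, x ∉ U → y ∉ U → K.Reachable x y := by
    intro x y hx hy
    set A : Finset V := {z | z ∉ U ∧ K.Adj x z} with hA
    set B : Finset V := {z | z ∉ U ∧ K.Adj y z} with hB
    have hAmem : ∀ z ∈ A, z ∉ U ∧ K.Adj x z := fun z hz => by simpa [hA] using hz
    have hBmem : ∀ z ∈ B, z ∉ U ∧ K.Adj y z := fun z hz => by simpa [hB] using hz
    by_cases hAB : Disjoint A B
    · obtain ⟨A', hA', hA'k⟩ := exists_subset_card_eq (s := A) (n := k) (by
        have : 2 * k ≤ #A := by convert hlarge x hx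
        omega)
      -- The at most `k` partners of `A'` under `J` are discarded from `B`, so that the edge found
      -- is not in `J`.
      set P : Finset V := A'.biUnion fun a => {z | z ∉ U ∧ J.Adj a z} with hP
      have hPcard : #P ≤ k := by
        refine card_biUnion_le.trans ?_
        rw [← hA'k, card_eq_sum_ones]
        exact sum_le_sum fun a ha => hJone a (hAmem a (hA' ha)).1
      obtain ⟨B', hB', hB'k⟩ := exists_subset_card_eq (s := B \ P) (n := k) (by
        have : 2 * k ≤ #B := by convert hlarge y hy
        have := le_card_sdiff P B
        omega)
      obtain ⟨a, ha, b, hb, hab⟩ := h A' B'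
        (hAB.mono hA' (hB'.trans sdiff_subset)) hA'k hB'k
      obtain ⟨hbB, hbP⟩ := mem_sdiff.1 (hB' hb)
      have hJab : ¬ J.Adj a b := by
        intro hJ
        refine hbP (mem_biUnion.2 ⟨a, ha, ?_⟩)
        simp [hJ, (hBmem b hbB).1]
      have hab' : K.Adj a b := (hKadj _ _).2 ⟨hab, hJab⟩
      exact ((hAmem a (hA' ha)).2.reachable.trans hab'.reachable).trans
        (hBmem b hbB).2.symm.reachable
    · obtain ⟨z, hzA, hzB⟩ := not_disjoint_iff.1 hAB
      exact (hAmem z hzA).2.reachable.trans (hBmem z hzB).2.symm.reachable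
  have hex : ∀ x, ∃ z, z ∉ U ∧ K.Reachable x z := by
    intro x
    by_cases hx : x ∈ U
    · obtain ⟨z, hz, hzJ⟩ : ∃ z ∈ G.neighborFinset x, z ∉ J.neighborFinset x := by
        refine exists_mem_notMem_of_card_lt_card ?_
        rw [card_neighborFinset_eq_degree, card_neighborFinset_eq_degree, hJU x hx]
        have := hdeg x
        omega
      rw [mem_neighborFinset] at hz hzJ
      have hadj : K.Adj x z := (hKadj _ _).2 ⟨hz, hzJ⟩
      exact ⟨z, fun hzU => hU hx hzU hz.ne hz, hadj.reachable⟩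
    · exact ⟨x, hx, .rfl⟩
  refine ⟨fun x y => ?_⟩
  obtain ⟨x', hx', hxx'⟩ := hex x
  obtain ⟨y', hy', hyy'⟩ := hex y
  exact (hxx'.trans (hout x' y' hx' hy')).trans hyy'.symm

/-- The properties of a random graph and of its complement on which the bounds for the Eulerian
edit numbers rely. -/
structure IsRobust (G : SimpleGraph V) (k : ℕ) : Prop where
  holeFree : G.HoleFree k k
  le_degree : ∀ x, 4 * k + 2 ≤ G.degree x
  hasCommonNeighbors : G.HasCommonNeighbors

/-- `J` is found in the complement; connectedness is inherited from `G`. -/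
theorem IsRobust.exists_mem_eulerianExtSet {k : ℕ} (hV : 4 ≤ Fintype.card V) (hG : G.IsRobust k)
    (hGc : Gᶜ.IsRobust k) : ∃ e ∈ G.eulerianExtSet, 2 * e ≤ #G.oddVerts + 2 * k := by
  have : Nonempty V := Fintype.card_pos_iff.1 (by omega)
  obtain ⟨m, hm⟩ := G.even_card_oddVerts
  obtain ⟨J, hJG, U, -, hJodd, hJcard, hU, -⟩ :=
    exists_le_oddVerts_eq hGc.hasCommonNeighbors m G.oddVerts (by omega)
  have hdisj : Disjoint G J := disjoint_compl_right.mono_right hJG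
  have hsdiff : (G ⊔ J).edgeSet \ G.edgeSet = J.edgeSet := by
    rw [edgeSet_sup, Set.union_sdiff_left, sdiff_eq_left]
    exact (disjoint_edgeSet.2 hdisj).symm
  refine ⟨J.edgeSet.ncard, ⟨G ⊔ J, le_sup_left, ?_, ?_⟩, ?_⟩
  · rw [hsdiff, Set.Finite.cast_ncard_eq (Set.toFinite _)]
  · refine isEulerianGraph_of_even_degree hV (hG.hasCommonNeighbors.connected.mono le_sup_left) ?_
    intro x
    rw [degree_of_eq_sup rfl hdisj, Nat.even_add, ← Nat.not_odd_iff_even, ← Nat.not_odd_iff_even,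
      ← mem_oddVerts, ← mem_oddVerts, hJodd]
  · have := hGc.holeFree.card_lt_of_isIndepSet hU
    omega

/-- Here `J` lies in `G` itself, and connectedness after its removal is the real issue. -/
theorem IsRobust.exists_mem_eulerianRedSet {k : ℕ} (hV : 4 ≤ Fintype.card V)
    (hG : G.IsRobust k) : ∃ e ∈ G.eulerianRedSet, 2 * e ≤ #G.oddVerts + 2 * k := by
  have : Nonempty V := Fintype.card_pos_iff.1 (by omega)
  obtain ⟨m, hm⟩ := G.even_card_oddVerts
  obtain ⟨J, hJG, U, -, hJodd, hJcard, hU, hJU, -, hJone⟩ :=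
    exists_le_oddVerts_eq hG.hasCommonNeighbors m G.oddVerts (by omega)
  have hsdiff : G.edgeSet \ (G \ J).edgeSet = J.edgeSet := by
    rw [edgeSet_sdiff, _root_.sdiff_sdiff_eq_self]
    exact edgeSet_subset_edgeSet.2 hJG
  refine ⟨J.edgeSet.ncard, ⟨G \ J, sdiff_le, ?_, ?_⟩, ?_⟩
  · rw [hsdiff, Set.Finite.cast_ncard_eq (Set.toFinite _)]
  · refine isEulerianGraph_of_even_degree hV
      (hG.holeFree.connected_sdiff hG.le_degree hU hJU hJone) ?_
    intro x
    have hdeg := degree_of_eq_sup (G := G \ J) (H := J) (K := G)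
      (by rw [sdiff_sup_cancel hJG]) disjoint_sdiff_self_left x
    have hx : Odd (J.degree x) ↔ Odd (G.degree x) := by
      rw [← mem_oddVerts, hJodd, mem_oddVerts]
    grind
  · have := hG.holeFree.card_lt_of_isIndepSet hU
    omega

/-- The three Eulerian edit numbers are at least half the number of vertices of odd degree, and for
robust graphs this bound is almost attained. -/
theorem IsRobust.eulerian_numbers {k : ℕ} (hV : 4 ≤ Fintype.card V) (hG : G.IsRobust k)
    (hGc : Gᶜ.IsRobust k) :
    (G.EulerianEditable ∧ #G.oddVerts ≤ 2 * G.eulerianEditNumber ∧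
      2 * G.eulerianEditNumber ≤ #G.oddVerts + 2 * k) ∧
    (G.EulerianExtendable ∧ #G.oddVerts ≤ 2 * G.eulerianExtNumber ∧
      2 * G.eulerianExtNumber ≤ #G.oddVerts + 2 * k) ∧
    (G.EulerianReducible ∧ #G.oddVerts ≤ 2 * G.eulerianRedNumber ∧
      2 * G.eulerianRedNumber ≤ #G.oddVerts + 2 * k) := by
  obtain ⟨e, he, hele⟩ := hG.exists_mem_eulerianExtSet hV hGc
  obtain ⟨f, hf, hfle⟩ := hG.exists_mem_eulerianRedSet hV
  have key : ∀ {S : Set ℕ}, S ⊆ G.eulerianEditSet → ∀ i ∈ S, 2 * i ≤ #G.oddVerts + 2 * k →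
      S.Nonempty ∧ #G.oddVerts ≤ 2 * sInf S ∧ 2 * sInf S ≤ #G.oddVerts + 2 * k := by
    intro S hS i hi hile
    refine ⟨⟨i, hi⟩, card_oddVerts_le_of_mem_eulerianEditSet (hS (Nat.sInf_mem ⟨i, hi⟩)), ?_⟩
    have := Nat.sInf_le hi
    omega
  exact ⟨key subset_rfl e (eulerianExtSet_subset_eulerianEditSet he) hele,
    key eulerianExtSet_subset_eulerianEditSet e he hele,
    key eulerianRedSet_subset_eulerianEditSet f hf hfle⟩

end Robust

/-! ### Union bounds in the binomial random graph -/

section Random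

open Finset MeasureTheory unitInterval
open scoped Classical

variable {V : Type*} [Fintype V] {p : I}

/-- As there are finitely many graphs, this makes every event measurable and every function
integrable. -/
instance : MeasurableSingletonClass (SimpleGraph V) where
  measurableSet_singleton G := by
    have : ({G} : Set (SimpleGraph V)) = edgeSet ⁻¹' {G.edgeSet} := by
      ext H; simp
    rw [this]
    exact measurable_edgeSet (measurableSet_singleton _)

theorem ncard_edgeSet_eq_card_filter (G : SimpleGraph V) :
    G.edgeSet.ncard = #{e ∈ (⊤ : SimpleGraph V).edgeFinset | e ∈ G.edgeSet} := by
  rw [← Set.ncard_coe_finset]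
  congr 1
  ext e
  simp only [coe_filter, mem_edgeFinset, Set.mem_ofPred_eq]
  exact ⟨fun h => ⟨edgeSet_subset_edgeSet.2 le_top h, h⟩, fun h => h.2⟩

theorem card_edgeFinset_top_eq : #(⊤ : SimpleGraph V).edgeFinset = (Nat.card V).choose 2 := by
  rw [Nat.card_eq_fintype_card, ← card_edgeFinset_top_eq_card_choose_two]

theorem binomialRandom_real_singleton (G : SimpleGraph V) :
    (binomialRandom V p).real {G} = (p : ℝ) ^ G.edgeSet.ncard *
      (1 - p : ℝ) ^ (#(⊤ : SimpleGraph V).edgeFinset - G.edgeSet.ncard) := by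
  rw [measureReal_def, binomialRandom_singleton, card_edgeFinset_top_eq]
  simp

/-- The expectation of a product of functions of the individual edges factorizes. -/
theorem integral_prod_edges (f g : Sym2 V → ℝ) :
    ∫ G, ∏ e ∈ (⊤ : SimpleGraph V).edgeFinset, (if e ∈ G.edgeSet then f e else g e)
      ∂(binomialRandom V p) =
      ∏ e ∈ (⊤ : SimpleGraph V).edgeFinset, (p * f e + (1 - p) * g e) := by
  rw [integral_fintype .of_finite, prod_add]
  refine sum_bij' (fun G _ => {e ∈ (⊤ : SimpleGraph V).edgeFinset | e ∈ G.edgeSet})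
    (fun t _ => fromEdgeSet t) ?_ ?_ ?_ ?_ ?_
  · intro G _
    simp
  · simp
  · intro G _
    rw [← edgeSet_inj]
    ext e
    simp only [coe_filter, mem_edgeFinset, edgeSet_fromEdgeSet, Set.mem_sdiff, Set.mem_ofPred_eq]
    constructor
    · tauto
    · intro h
      exact ⟨⟨edgeSet_subset_edgeSet.2 le_top h, h⟩, G.not_isDiag_of_mem_edgeSet h⟩
  · intro t ht
    ext e
    have := mem_powerset.1 ht (x := e)
    simp only [mem_filter, mem_edgeFinset, edgeSet_fromEdgeSet, Set.mem_sdiff, mem_coe] at this ⊢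
    constructor
    · tauto
    · intro h
      exact ⟨this h, h, not_isDiag_of_mem_edgeSet _ (this h)⟩
  · intro G _
    rw [binomialRandom_real_singleton, prod_ite, ncard_edgeSet_eq_card_filter, prod_mul_distrib,
      prod_mul_distrib, prod_const, prod_const, ← card_sdiff_of_subset (filter_subset _ _),
      filter_not, smul_eq_mul]
    ring

theorem measureReal_le_integral_of_one_le {S : Set (SimpleGraph V)} {f : SimpleGraph V → ℝ}
    (hf : ∀ G, 0 ≤ f G) (hS : ∀ G ∈ S, 1 ≤ f G) :
    (binomialRandom V p).real S ≤ ∫ G, f G ∂(binomialRandom V p) := by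
  rw [← integral_indicator_one (Set.toFinite S).measurableSet]
  refine integral_mono .of_finite .of_finite fun G => ?_
  by_cases hG : G ∈ S
  · simpa [hG] using hS G hG
  · simpa [hG] using hf G

/-- The indicator is a product over potential edges, with expected factor `p` on `A`, `1 - p` on `B`
and `1` elsewhere. -/
theorem measureReal_edges_le {A B : Finset (Sym2 V)} (hAB : Disjoint A B)
    (hA : A ⊆ (⊤ : SimpleGraph V).edgeFinset) (hB : B ⊆ (⊤ : SimpleGraph V).edgeFinset) :
    (binomialRandom V p).real {G | (∀ e ∈ A, e ∈ G.edgeSet) ∧ ∀ e ∈ B, e ∉ G.edgeSet} ≤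
      (p : ℝ) ^ #A * (1 - p : ℝ) ^ #B := by
  refine (measureReal_le_integral_of_one_le
    (f := fun G => ∏ e ∈ (⊤ : SimpleGraph V).edgeFinset,
      if e ∈ G.edgeSet then (if e ∈ B then 0 else 1) else (if e ∈ A then 0 else 1)) ?_ ?_).trans_eq ?_
  · intro G
    exact prod_nonneg fun e _ => by split_ifs <;> norm_num
  · rintro G ⟨hGA, hGB⟩
    refine (prod_eq_one fun e _ => ?_).ge
    have := hGA e
    have := hGB e
    split_ifs <;> tauto
  · rw [integral_prod_edges]
    have : ∀ e ∈ (⊤ : SimpleGraph V).edgeFinset,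
        ((p : ℝ) * (if e ∈ B then 0 else 1) + (1 - p) * (if e ∈ A then 0 else 1)) =
          (if e ∈ A then (p : ℝ) else 1) * (if e ∈ B then (1 - p : ℝ) else 1) := by
      intro e _
      have : e ∈ A → e ∉ B := fun h => Finset.disjoint_left.1 hAB h
      split_ifs <;> first | tauto | ring
    rw [prod_congr rfl this, prod_mul_distrib, prod_ite_mem, prod_ite_mem, prod_const, prod_const,
      inter_eq_right.2 hA, inter_eq_right.2 hB]

/-- The potential edges between `A` and `B`. -/
noncomputable def crossEdges (A B : Finset V) : Finset (Sym2 V) :=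
  (A ×ˢ B).image fun x => s(x.1, x.2)

omit [Fintype V] in
@[simp]
theorem mk_mem_crossEdges {A B : Finset V} {a b : V} :
    s(a, b) ∈ crossEdges A B ↔ a ∈ A ∧ b ∈ B ∨ b ∈ A ∧ a ∈ B := by
  simp only [crossEdges, mem_image, mem_product, Prod.exists, Sym2.eq_iff]
  grind

omit [Fintype V] in
theorem card_crossEdges {A B : Finset V} (h : Disjoint A B) : #(crossEdges A B) = #A * #B := by
  rw [crossEdges, card_image_of_injOn, card_product]
  rintro ⟨a, b⟩ hx ⟨a', b'⟩ hy hxy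
  simp only [coe_product, Set.mem_prod, mem_coe] at hx hy
  rw [Sym2.eq_iff] at hxy
  have h1 := Finset.disjoint_left.1 h hx.1
  grind

theorem crossEdges_subset {A B : Finset V} (h : Disjoint A B) :
    crossEdges A B ⊆ (⊤ : SimpleGraph V).edgeFinset := by
  intro e he
  induction e with
  | _ a b =>
  rw [mem_edgeFinset, mem_edgeSet, top_adj]
  rintro rfl
  rw [mk_mem_crossEdges] at he
  exact Finset.disjoint_left.1 h (show a ∈ A by tauto) (by tauto)

theorem measureReal_not_holeFree_le (a b : ℕ) :
    (binomialRandom V p).real {G | ¬ G.HoleFree a b} ≤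
      (Fintype.card V).choose a * (Fintype.card V).choose b * (1 - p : ℝ) ^ (a * b) := by
  have hp : (0 : ℝ) ≤ 1 - p := by linarith [p.2.2]
  -- Disjointness is made part of the event, so that the index set is a full product counted by
  -- binomial coefficients.
  have hsub : {G : SimpleGraph V | ¬ G.HoleFree a b} ⊆
      ⋃ x ∈ (univ : Finset V).powersetCard a ×ˢ (univ : Finset V).powersetCard b,
        {G | Disjoint x.1 x.2 ∧ ∀ e ∈ crossEdges x.1 x.2, e ∉ G.edgeSet} := by
    intro G hG
    simp only [HoleFree, Set.mem_ofPred_eq, not_forall, not_exists, not_and] at hG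
    obtain ⟨A, B, hAB, hA, hB, h⟩ := hG
    simp only [Set.mem_iUnion]
    refine ⟨(A, B), by simp [mem_powersetCard, hA, hB], hAB, ?_⟩
    intro e
    induction e with
    | _ x y =>
    rw [mk_mem_crossEdges, mem_edgeSet]
    rintro (⟨hx, hy⟩ | ⟨hy, hx⟩) hxy
    · exact h x hx y hy hxy
    · exact h y hy x hx hxy.symm
  refine (measureReal_mono hsub (measure_ne_top _ _)).trans ((measureReal_biUnion_finset_le _ _).trans ?_)
  refine (sum_le_card_nsmul _ _ ((1 - p : ℝ) ^ (a * b)) ?_).trans_eq ?_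
  · rintro ⟨A, B⟩ hx
    simp only [mem_product, mem_powersetCard, subset_univ, true_and] at hx
    by_cases hAB : Disjoint A B
    · refine le_trans (measureReal_mono ?_) ((measureReal_edges_le (disjoint_empty_left _)
        (empty_subset _) (crossEdges_subset hAB)).trans_eq ?_)
      · rintro G ⟨-, hG⟩
        exact ⟨by simp, hG⟩
      · rw [card_crossEdges hAB, hx.1, hx.2]; simp
    · simp only [hAB, false_and, Set.ofPred_false, measureReal_empty]
      positivity
  · rw [card_product, card_powersetCard, card_powersetCard, card_univ, nsmul_eq_mul]
    push_cast
    ring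

/-- Split by the set `S` of neighbours of `u` in `W`: then `v` misses `S`, which has weight `p^#S
(1-p)^(#W-#S) (1-p)^#S`. The binomial theorem sums this to `((1+p)(1-p))^#W`. -/
theorem measureReal_no_common_neighbor_le {u v : V} (huv : u ≠ v) :
    (binomialRandom V p).real {G | ¬ ∃ w, G.Adj u w ∧ G.Adj v w} ≤
      (1 - p ^ 2 : ℝ) ^ (Fintype.card V - 2) := by
  set W : Finset V := univ \ {u, v} with hW
  have hWcard : #W = Fintype.card V - 2 := by
    rw [hW, card_univ_sdiff, card_pair huv]
  have huW : u ∉ W := by simp [hW]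
  have hvW : v ∉ W := by simp [hW]
  have hsub : {G : SimpleGraph V | ¬ ∃ w, G.Adj u w ∧ G.Adj v w} ⊆ ⋃ S ∈ W.powerset,
      {G | (∀ e ∈ crossEdges {u} S, e ∈ G.edgeSet) ∧
        ∀ e ∈ crossEdges {u} (W \ S) ∪ crossEdges {v} S, e ∉ G.edgeSet} := by
    intro G hG
    simp only [Set.mem_ofPred_eq, not_exists, not_and] at hG
    simp only [Set.mem_iUnion]
    refine ⟨W.filter (G.Adj u ·), by simp, ?_, ?_⟩
    · intro e
      induction e with
      | _ x y =>
      simp only [mk_mem_crossEdges, Finset.mem_singleton, mem_filter, mem_edgeSet]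
      rintro (⟨rfl, -, h⟩ | ⟨rfl, -, h⟩)
      · exact h
      · exact h.symm
    · intro e
      induction e with
      | _ x y =>
      simp only [mem_union, mk_mem_crossEdges, Finset.mem_singleton, mem_filter, mem_sdiff,
        mem_edgeSet]
      have h1 := hG x
      have h2 := hG y
      have h3 := G.adj_comm x y
      grind
  refine (measureReal_mono hsub (measure_ne_top _ _)).trans ((measureReal_biUnion_finset_le _ _).trans ?_)
  have hterm : ∀ S ∈ W.powerset, (binomialRandom V p).real
      {G | (∀ e ∈ crossEdges {u} S, e ∈ G.edgeSet) ∧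
        ∀ e ∈ crossEdges {u} (W \ S) ∪ crossEdges {v} S, e ∉ G.edgeSet} ≤
      ((p : ℝ) ^ #S * 1 ^ (#W - #S)) * (1 - p : ℝ) ^ #W := by
    intro S hS
    rw [mem_powerset] at hS
    have huS : u ∉ S := fun h => huW (hS h)
    have hvS : v ∉ S := fun h => hvW (hS h)
    have d1 : Disjoint {u} S := by simpa
    have d2 : Disjoint {u} (W \ S) := by simp [huW]
    have d3 : Disjoint {v} S := by simpa
    have d4 : Disjoint (crossEdges {u} (W \ S)) (crossEdges {v} S) := by
      rw [Finset.disjoint_left]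
      intro e
      induction e with
      | _ x y =>
      simp only [mk_mem_crossEdges, Finset.mem_singleton, mem_sdiff]
      grind
    have d5 : Disjoint (crossEdges {u} S) (crossEdges {u} (W \ S) ∪ crossEdges {v} S) := by
      rw [Finset.disjoint_left]
      intro e
      induction e with
      | _ x y =>
      simp only [mem_union, mk_mem_crossEdges, Finset.mem_singleton, mem_sdiff]
      grind
    refine (measureReal_edges_le d5 (crossEdges_subset d1)
      (union_subset (crossEdges_subset d2) (crossEdges_subset d3))).trans_eq ?_
    rw [card_union_of_disjoint d4, card_crossEdges d1, card_crossEdges d2, card_crossEdges d3,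
      card_singleton, card_singleton, one_mul, one_mul, card_sdiff_add_card_eq_card hS,
      one_pow, mul_one]
  refine (sum_le_sum hterm).trans_eq ?_
  rw [← sum_mul, sum_pow_mul_eq_add_pow, ← mul_pow, hWcard]
  ring

theorem measureReal_not_hasCommonNeighbors_le :
    (binomialRandom V p).real {G | ¬ G.HasCommonNeighbors} ≤
      (Fintype.card V : ℝ) ^ 2 * (1 - p ^ 2 : ℝ) ^ (Fintype.card V - 2) := by
  have hp : (0 : ℝ) ≤ 1 - p ^ 2 := by nlinarith [p.2.1, p.2.2]
  have hsub : {G : SimpleGraph V | ¬ G.HasCommonNeighbors} ⊆ ⋃ x ∈ (univ : Finset (V × V)),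
      {G | x.1 ≠ x.2 ∧ ¬ ∃ w, G.Adj x.1 w ∧ G.Adj x.2 w} := by
    intro G hG
    simp only [HasCommonNeighbors, Set.mem_ofPred_eq, not_forall] at hG
    obtain ⟨u, v, huv, h⟩ := hG
    simp only [Set.mem_iUnion]
    exact ⟨(u, v), mem_univ _, huv, h⟩
  refine (measureReal_mono hsub (measure_ne_top _ _)).trans ((measureReal_biUnion_finset_le _ _).trans ?_)
  refine (sum_le_card_nsmul _ _ ((1 - p ^ 2 : ℝ) ^ (Fintype.card V - 2)) ?_).trans_eq ?_
  · rintro ⟨u, v⟩ -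
    by_cases huv : u = v
    · simp only [huv, ne_eq, not_true, false_and, Set.ofPred_false, measureReal_empty]
      positivity
    · refine (measureReal_mono ?_).trans (measureReal_no_common_neighbor_le huv)
      exact fun G hG => hG.2
  · rw [card_univ, Fintype.card_prod, nsmul_eq_mul]
    push_cast
    ring

theorem measureReal_not_isRobust_le (k : ℕ) :
    (binomialRandom V p).real {G | ¬ G.IsRobust k} ≤
      (Fintype.card V).choose k * (Fintype.card V).choose k * (1 - p : ℝ) ^ (k * k) +
      (Fintype.card V).choose 1 * (Fintype.card V).choose (Fintype.card V - (4 * k + 2)) *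
        (1 - p : ℝ) ^ (1 * (Fintype.card V - (4 * k + 2))) +
      (Fintype.card V : ℝ) ^ 2 * (1 - p ^ 2 : ℝ) ^ (Fintype.card V - 2) := by
  have hsub : {G : SimpleGraph V | ¬ G.IsRobust k} ⊆ {G | ¬ G.HoleFree k k} ∪
      {G | ¬ G.HoleFree 1 (Fintype.card V - (4 * k + 2))} ∪ {G | ¬ G.HasCommonNeighbors} := by
    intro G hG
    by_contra h
    simp only [Set.mem_union, Set.mem_ofPred_eq, not_or, not_not] at h
    exact hG ⟨h.1.1, h.1.2.le_degree, h.2⟩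
  refine (measureReal_mono hsub (measure_ne_top _ _)).trans ?_
  refine (measureReal_union_le _ _).trans ?_
  refine add_le_add ((measureReal_union_le _ _).trans ?_) measureReal_not_hasCommonNeighbors_le
  exact add_le_add (measureReal_not_holeFree_le _ _) (measureReal_not_holeFree_le _ _)

/-- Complementation exchanges edges and non-edges, hence `p` and `1 - p` in the weight of each
graph. -/
theorem measureReal_compl_mem (S : Set (SimpleGraph V)) :
    (binomialRandom V p).real {G | Gᶜ ∈ S} = (binomialRandom V (σ p)).real S := by
  rw [← integral_indicator_one (Set.toFinite S).measurableSet,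
    ← integral_indicator_one (Set.toFinite {G : SimpleGraph V | Gᶜ ∈ S}).measurableSet,
    integral_fintype .of_finite, integral_fintype .of_finite]
  refine Fintype.sum_equiv (compl_involutive (α := SimpleGraph V)).toPerm _ _ fun G => ?_
  have hle : G.edgeSet.ncard ≤ #(⊤ : SimpleGraph V).edgeFinset := by
    rw [ncard_edgeSet_eq_card_filter]
    exact card_filter_le _ _
  have hcard : Gᶜ.edgeSet.ncard = #(⊤ : SimpleGraph V).edgeFinset - G.edgeSet.ncard := by
    rw [ncard_edgeSet_eq_card_filter, ncard_edgeSet_eq_card_filter,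
      ← card_sdiff_of_subset (filter_subset _ _), ← filter_not]
    congr 1
    ext e
    induction e with
    | _ a b => simp +contextual [compl_adj]
  simp only [Function.Involutive.coe_toPerm]
  rw [binomialRandom_real_singleton, binomialRandom_real_singleton, hcard,
    Nat.sub_sub_self hle, coe_symm_eq, sub_sub_cancel, mul_comm ((p : ℝ) ^ _)]
  rfl

end Random

/-! ### Concentration of the number of odd vertices -/

section Parity

open Finset MeasureTheory unitInterval
open scoped Classical

variable {V : Type*} [Fintype V] {p : I}

theorem neg_one_pow_degree (G : SimpleGraph V) (v : V) :
    (-1 : ℝ) ^ G.degree v = ∏ e ∈ (⊤ : SimpleGraph V).edgeFinset,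
      if e ∈ G.edgeSet then (if v ∈ e then -1 else 1) else 1 := by
  have h : ∀ e ∈ (⊤ : SimpleGraph V).edgeFinset,
      (if e ∈ G.edgeSet then (if v ∈ e then (-1 : ℝ) else 1) else 1) =
        if e ∈ G.incidenceFinset v then -1 else 1 := by
    intro e _
    simp only [mem_incidenceFinset, incidenceSet, Set.mem_ofPred_eq, ite_and]
  rw [prod_congr rfl h, prod_ite_mem, prod_const, inter_eq_right.2, card_incidenceFinset_eq_degree]
  intro e he
  rw [mem_incidenceFinset] at he
  rw [mem_edgeFinset]
  exact edgeSet_subset_edgeSet.2 le_top he.1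

/-- A present edge contributes `-1` exactly if one of its ends lies in `S`, with mean `1 - 2p`; all
other edges contribute `1`. -/
theorem abs_integral_prod_neg_one_pow_degree_le (S : Finset V) :
    |∫ G, ∏ v ∈ S, (-1 : ℝ) ^ G.degree v ∂(binomialRandom V p)| ≤
      |1 - 2 * (p : ℝ)| ^ (#S * (Fintype.card V - #S)) := by
  have h : ∀ G : SimpleGraph V, ∏ v ∈ S, (-1 : ℝ) ^ G.degree v =
      ∏ e ∈ (⊤ : SimpleGraph V).edgeFinset,
        if e ∈ G.edgeSet then (∏ v ∈ S, if v ∈ e then -1 else 1) else 1 := by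
    intro G
    simp_rw [neg_one_pow_degree]
    rw [prod_comm]
    refine prod_congr rfl fun e _ => ?_
    split_ifs <;> simp
  have habs : |1 - 2 * (p : ℝ)| ≤ 1 := by
    rw [abs_le]; constructor <;> linarith [p.2.1, p.2.2]
  have hdisj : Disjoint S (univ \ S) := disjoint_sdiff
  simp_rw [h]
  rw [integral_prod_edges, abs_prod]
  calc _ ≤ ∏ e ∈ (⊤ : SimpleGraph V).edgeFinset,
        if e ∈ crossEdges S (univ \ S) then |1 - 2 * (p : ℝ)| else 1 := by
        refine prod_le_prod (fun e _ => abs_nonneg _) fun e he => ?_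
        induction e with
        | _ a b =>
        have hab : a ≠ b := by
          rwa [mem_edgeFinset, mem_edgeSet, top_adj] at he
        have hprod : (∏ v ∈ S, if v ∈ s(a, b) then (-1 : ℝ) else 1) =
            (if a ∈ S then -1 else 1) * (if b ∈ S then -1 else 1) := by
          have : ∀ v ∈ S, (if v ∈ s(a, b) then (-1 : ℝ) else 1) =
              (if v = a then -1 else 1) * (if v = b then -1 else 1) := by
            intro v _
            simp only [Sym2.mem_iff]
            grind
          rw [prod_congr rfl this, prod_mul_distrib, prod_ite_eq', prod_ite_eq']
        rw [hprod]
        simp only [mk_mem_crossEdges, mem_sdiff, mem_univ, true_and]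
        by_cases ha : a ∈ S <;> by_cases hb : b ∈ S <;> simp [ha, hb]
        · exact le_of_eq (by congr 1; ring)
        · exact le_of_eq (by congr 1; ring)
    _ = _ := by
        rw [prod_ite_mem, prod_const, inter_eq_right.2 (crossEdges_subset hdisj),
          card_crossEdges hdisj, card_univ_sdiff]

theorem sum_neg_one_pow_degree (G : SimpleGraph V) :
    ∑ v, (-1 : ℝ) ^ G.degree v = Fintype.card V - 2 * #G.oddVerts := by
  have h : ∀ v, (-1 : ℝ) ^ G.degree v = 1 - 2 * (if v ∈ G.oddVerts then 1 else 0) := by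
    intro v
    split_ifs with hv <;> rw [mem_oddVerts] at hv
    · rw [hv.neg_one_pow]; norm_num
    · rw [(Nat.not_odd_iff_even.1 hv).neg_one_pow]; norm_num
  simp_rw [h, sum_sub_distrib, ← mul_sum]
  simp [oddVerts]

/-- For a sign `s`, `exp (t s) = cosh t + s sinh t`; the product over the vertices is expanded. -/
theorem exp_sum_neg_one_pow (G : SimpleGraph V) (t : ℝ) :
    Real.exp (t * ∑ v, (-1 : ℝ) ^ G.degree v) =
      ∑ S : Finset V, Real.sinh t ^ #S * Real.cosh t ^ (Fintype.card V - #S) *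
        ∏ v ∈ S, (-1 : ℝ) ^ G.degree v := by
  have h : ∀ v, Real.exp (t * (-1 : ℝ) ^ G.degree v) =
      Real.sinh t * (-1 : ℝ) ^ G.degree v + Real.cosh t := by
    intro v
    rcases neg_one_pow_eq_or ℝ (G.degree v) with h | h <;> rw [h]
    · rw [mul_one, mul_one, Real.sinh_add_cosh]
    · rw [mul_neg_one, mul_neg_one, ← Real.cosh_sub_sinh]; ring
  rw [mul_sum, Real.exp_sum, prod_congr rfl fun v _ => h v, prod_add, powerset_univ]
  refine sum_congr rfl fun S _ => ?_
  rw [prod_mul_distrib, prod_const, prod_const, card_univ_sdiff]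
  ring

/-- The moment generating function of the difference of the numbers of vertices of even and of odd
degree is comparable with that of a sum of independent signs. -/
theorem integral_exp_sum_neg_one_pow_le {q : ℝ} (hq : 0 ≤ q) (hqp : q ≤ p) (hpq : p ≤ 1 - q)
    (hV : Fintype.card V * Real.exp (-(q * Fintype.card V)) ≤ 1) (t : ℝ) :
    ∫ G, Real.exp (t * ∑ v, (-1 : ℝ) ^ G.degree v) ∂(binomialRandom V p) ≤
      6 * Real.exp (Fintype.card V * t ^ 2 / 2) := by
  set n := Fintype.card V with hn
  set x := Real.exp (-(q * n)) with hx
  have habs : |1 - 2 * (p : ℝ)| ≤ Real.exp (-(2 * q)) := by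
    have := Real.add_one_le_exp (-(2 * q))
    rw [abs_le]; constructor <;> linarith
  have hcosh : 0 < Real.cosh t := Real.cosh_pos t
  have hsinh : |Real.sinh t| ≤ Real.cosh t := by
    rw [abs_le]
    constructor
    · have := Real.exp_pos t
      rw [← Real.cosh_add_sinh] at this
      linarith
    · exact (Real.sinh_lt_cosh t).le
  -- The larger of `#S` and `n - #S` is at least `n / 2`, so the exponent `2 q #S (n - #S)` is at
  -- least `q n` times the smaller.
  have hpow : ∀ S : Finset V, |1 - 2 * (p : ℝ)| ^ (#S * (n - #S)) ≤ x ^ #S + x ^ (n - #S) := by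
    intro S
    have hS : #S ≤ n := card_le_univ S
    refine (pow_le_pow_left₀ (abs_nonneg _) habs _).trans ?_
    rw [hx, ← Real.exp_nat_mul, ← Real.exp_nat_mul, ← Real.exp_nat_mul]
    push_cast [hS]
    have hS' : (#S : ℝ) ≤ n := by exact_mod_cast hS
    have hS0 : (0 : ℝ) ≤ #S := by positivity
    rcases le_total (2 * (#S : ℝ)) n with h | h
    · refine le_trans (Real.exp_le_exp.2 ?_) (le_add_of_nonneg_right (Real.exp_pos _).le)
      nlinarith [mul_nonneg (mul_nonneg hq hS0) (sub_nonneg.2 h)]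
    · refine le_trans (Real.exp_le_exp.2 ?_) (le_add_of_nonneg_left (Real.exp_pos _).le)
      nlinarith [mul_nonneg (mul_nonneg hq (sub_nonneg.2 hS')) (sub_nonneg.2 h)]
  have hterm : ∀ S : Finset V, ∫ G, Real.sinh t ^ #S * Real.cosh t ^ (n - #S) *
      ∏ v ∈ S, (-1 : ℝ) ^ G.degree v ∂(binomialRandom V p) ≤
      Real.cosh t ^ n * (x ^ #S * 1 ^ (n - #S) + 1 ^ #S * x ^ (n - #S)) := by
    intro S
    have hS : #S ≤ n := card_le_univ S
    rw [integral_const_mul]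
    refine (le_abs_self _).trans ?_
    rw [abs_mul, abs_mul, abs_pow, abs_pow, abs_of_pos hcosh, one_pow, one_pow, mul_one, one_mul]
    refine mul_le_mul ?_ ((abs_integral_prod_neg_one_pow_degree_le S).trans (hpow S))
      (abs_nonneg _) (by positivity)
    calc |Real.sinh t| ^ #S * Real.cosh t ^ (n - #S)
        ≤ Real.cosh t ^ #S * Real.cosh t ^ (n - #S) := by gcongr
      _ = Real.cosh t ^ n := by rw [← pow_add, Nat.add_sub_cancel' hS]
  simp_rw [exp_sum_neg_one_pow]
  rw [integral_finsetSum _ fun _ _ => .of_finite]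
  refine (sum_le_sum fun S _ => hterm S).trans ?_
  rw [← mul_sum, sum_add_distrib, hn, Fintype.sum_pow_mul_eq_add_pow,
    Fintype.sum_pow_mul_eq_add_pow, ← hn]
  -- `(1 + x)^n ≤ exp (n x) ≤ e` by `hV`; the two sums together give the factor 6.
  have h1 : (x + 1) ^ n ≤ 3 := by
    calc (x + 1) ^ n ≤ Real.exp x ^ n := by
          have := Real.exp_pos (-(q * n))
          gcongr
          exact Real.add_one_le_exp x
      _ = Real.exp (n * x) := by rw [Real.exp_nat_mul]
      _ ≤ Real.exp 1 := Real.exp_le_exp.2 hV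
      _ ≤ 3 := by linarith [Real.exp_one_lt_d9]
  have h2 : Real.cosh t ^ n ≤ Real.exp (n * t ^ 2 / 2) := by
    calc Real.cosh t ^ n ≤ Real.exp (t ^ 2 / 2) ^ n := by
          gcongr
          exact Real.cosh_le_exp_half_sq t
      _ = Real.exp (n * t ^ 2 / 2) := by rw [← Real.exp_nat_mul]; ring_nf
  calc Real.cosh t ^ n * ((x + 1) ^ n + (1 + x) ^ n) ≤ Real.exp (n * t ^ 2 / 2) * 6 := by
        rw [add_comm 1 x]
        refine mul_le_mul h2 (by linarith) (by positivity) (Real.exp_pos _).le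
    _ = _ := by ring

/-- The number of vertices of odd degree of a random graph is concentrated about one half of the
number of vertices. -/
theorem measureReal_oddVerts_deviation_le [Nonempty V] {q : ℝ} (hq : 0 ≤ q) (hqp : q ≤ p)
    (hpq : p ≤ 1 - q) (hV : Fintype.card V * Real.exp (-(q * Fintype.card V)) ≤ 1) {l : ℝ}
    (hl : 0 ≤ l) :
    (binomialRandom V p).real {G | l < |(Fintype.card V : ℝ) - 2 * #G.oddVerts|} ≤
      12 * Real.exp (-(l ^ 2 / (2 * Fintype.card V))) := by
  set n := Fintype.card V with hn
  have hn0 : (0 : ℝ) < n := by exact_mod_cast Fintype.card_pos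
  -- The minimiser of `-t l + n t² / 2`.
  set t := l / n with ht
  have ht0 : 0 ≤ t := by positivity
  refine (measureReal_le_integral_of_one_le
    (f := fun G => Real.exp (-(t * l)) * (Real.exp (t * ∑ v, (-1 : ℝ) ^ G.degree v) +
      Real.exp ((-t) * ∑ v, (-1 : ℝ) ^ G.degree v))) ?_ ?_).trans ?_
  · intro G; positivity
  · intro G hG
    rw [Set.mem_ofPred_eq] at hG
    rw [sum_neg_one_pow_degree, ← hn, mul_add, ← Real.exp_add, ← Real.exp_add]
    rcases lt_abs.1 hG with h | h
    · refine le_trans (Real.one_le_exp ?_) (le_add_of_nonneg_right (Real.exp_pos _).le)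
      nlinarith
    · refine le_trans (Real.one_le_exp ?_) (le_add_of_nonneg_left (Real.exp_pos _).le)
      nlinarith
  · rw [integral_const_mul, integral_add .of_finite .of_finite]
    have h1 := integral_exp_sum_neg_one_pow_le hq hqp hpq hV t
    have h2 := integral_exp_sum_neg_one_pow_le hq hqp hpq hV (-t)
    rw [neg_sq] at h2
    calc _ ≤ Real.exp (-(t * l)) * (6 * Real.exp (n * t ^ 2 / 2) + 6 * Real.exp (n * t ^ 2 / 2)) := by
          gcongr
      _ = 12 * (Real.exp (-(t * l)) * Real.exp (n * t ^ 2 / 2)) := by ring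
      _ = _ := by
          rw [← Real.exp_add, ht]
          congr 2
          field_simp
          ring

end Parity

/-! ### Asymptotic estimates -/

section Asymptotics

open MeasureTheory unitInterval Filter

theorem choose_le_exp (n k : ℕ) (hn : 0 < n) : (n.choose k : ℝ) ≤ Real.exp (k * Real.log n) := by
  have hn' : (0 : ℝ) < n := by exact_mod_cast hn
  rw [Real.exp_nat_mul, Real.exp_log hn']
  exact_mod_cast Nat.choose_le_pow n k

theorem one_sub_pow_le_exp {x y : ℝ} (hxy : y ≤ x) (hx : x ≤ 1) (m : ℕ) :
    (1 - x) ^ m ≤ Real.exp (-(y * m)) := by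
  have h : 1 - x ≤ Real.exp (-y) := by
    have := Real.add_one_le_exp (-y)
    linarith
  calc (1 - x) ^ m ≤ Real.exp (-y) ^ m := pow_le_pow_left₀ (by linarith) h m
    _ = Real.exp (-(y * m)) := by rw [← Real.exp_nat_mul]; ring_nf

/-- With `s = √n`, `L = log n` and `q = L² / s`, counting costs exponents of order `sL`, `sL` and
`L` for holes, degrees and common neighbours. The gains `q k²`, `q n / 2` and `q² n / 2` are at
least `sL²`, `sL² / 2` and `L⁴ / 2`. -/
theorem measureReal_not_isRobust_le_exp {n : ℕ} {p : I} {r : ℝ}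
    (hp : Real.log n ^ 2 / √n ≤ p) (hL : 22 ≤ Real.log n) (hLr : r + 3 ≤ Real.log n)
    (hs : 10 ≤ √(n : ℝ)) (hsr : r + 1 ≤ √(n : ℝ)) :
    (binomialRandom (Fin n) p).real {G | ¬ G.IsRobust ⌈√(n : ℝ)⌉₊} ≤
      3 * Real.exp (-((r + 1) * Real.log n)) := by
  set L := Real.log n with hLdef
  set s := √(n : ℝ) with hsdef
  have hs0 : 0 < s := by linarith
  have hss : s ^ 2 = n := Real.sq_sqrt (Nat.cast_nonneg n)
  have hn0 : 0 < n := by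
    rw [Nat.pos_iff_ne_zero]
    rintro rfl
    norm_num [hsdef] at hs
  have hnexp : (n : ℝ) = Real.exp L := by
    rw [hLdef, Real.exp_log (by exact_mod_cast hn0)]
  obtain ⟨k, hk⟩ : ∃ k, k = ⌈s⌉₊ := ⟨_, rfl⟩
  rw [← hk]
  have hk1 : s ≤ k := hk ▸ Nat.le_ceil s
  have hk2 : (k : ℝ) ≤ s + 1 := hk ▸ (Nat.ceil_lt_add_one hs0.le).le
  obtain ⟨d, hd⟩ : ∃ d, d = 4 * k + 2 := ⟨_, rfl⟩
  have hdr : (d : ℝ) = 4 * k + 2 := by rw [hd]; push_cast; ring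
  -- `10 ≤ s` is used here: `4 (s + 1) + 2 ≤ s² / 2`.
  have hdn' : (d : ℝ) ≤ n / 2 := by nlinarith
  have hdn : d ≤ n := by
    have : (d : ℝ) ≤ n := by linarith [(Nat.cast_nonneg n : (0 : ℝ) ≤ n)]
    exact_mod_cast this
  have hn100 : (100 : ℝ) ≤ n := by nlinarith
  have hn2 : 2 ≤ n := by
    have : (2 : ℝ) ≤ n := by linarith
    exact_mod_cast this
  set q := L ^ 2 / s with hq
  have hqs : q * s = L ^ 2 := by rw [hq]; field_simp
  have hq0 : 0 ≤ q := by positivity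
  have hqn : q * n = L ^ 2 * s := by rw [← hss, ← hqs]; ring
  have hq2 : q ^ 2 * n = L ^ 4 := by rw [← hss, ← mul_pow, hqs]; ring
  have hp1 : (p : ℝ) ≤ 1 := p.2.2
  have hLs : (r + 1) * L ≤ s * L := by gcongr
  have hL10 : 10 * L ≤ s * L := by gcongr
  have hL1 : s * L * 22 ≤ s * L * L := by gcongr
  refine (measureReal_not_isRobust_le k).trans ?_
  rw [Fintype.card_fin, ← hd, one_mul, Nat.choose_one_right, Nat.choose_symm hdn]
  have t1 : (n.choose k : ℝ) * n.choose k * (1 - p : ℝ) ^ (k * k) ≤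
      Real.exp (-((r + 1) * L)) := by
    have h1 := choose_le_exp n k hn0
    have h2 := one_sub_pow_le_exp hp hp1 (k * k)
    have h0 : (0 : ℝ) ≤ (1 - p) ^ (k * k) := pow_nonneg (by linarith) _
    calc _ ≤ Real.exp (k * L) * Real.exp (k * L) * Real.exp (-(q * (k * k : ℕ))) := by gcongr
      _ = Real.exp (k * L + k * L + -(q * (k * k : ℕ))) := by rw [Real.exp_add, Real.exp_add]
      _ ≤ _ := by
        refine Real.exp_le_exp.2 ?_
        push_cast
        have h3 : q * (s * s) ≤ q * (k * k) := by gcongr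
        have h4 : q * (s * s) = s * L * L := by rw [← mul_assoc, hqs]; ring
        have h5 : k * L ≤ (s + 1) * L := by gcongr
        linarith
  have t2 : (n : ℝ) * n.choose d * (1 - p : ℝ) ^ (n - d) ≤ Real.exp (-((r + 1) * L)) := by
    have h1 := choose_le_exp n d hn0
    have h2 := one_sub_pow_le_exp hp hp1 (n - d)
    have h0 : (0 : ℝ) ≤ (1 - p) ^ (n - d) := pow_nonneg (by linarith) _
    calc _ ≤ Real.exp L * Real.exp (d * L) * Real.exp (-(q * (n - d : ℕ))) := by
          gcongr
          exact hnexp.le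
      _ = Real.exp (L + d * L + -(q * (n - d : ℕ))) := by rw [Real.exp_add, Real.exp_add]
      _ ≤ _ := by
        refine Real.exp_le_exp.2 ?_
        rw [Nat.cast_sub hdn]
        have h3 : q * (n / 2) ≤ q * (n - d) := by gcongr; linarith
        have h4 : q * (n / 2) = s * L * L / 2 := by rw [← mul_div_assoc, hqn]; ring
        have h5 : d * L ≤ (4 * (s + 1) + 2) * L := by gcongr; linarith
        linarith
  have t3 : (n : ℝ) ^ 2 * (1 - p ^ 2 : ℝ) ^ (n - 2) ≤ Real.exp (-((r + 1) * L)) := by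
    have hqp2 : q ^ 2 ≤ (p : ℝ) ^ 2 := by gcongr
    have h2 := one_sub_pow_le_exp hqp2 (pow_le_one₀ p.2.1 hp1) (n - 2)
    calc _ ≤ (n : ℝ) ^ 2 * Real.exp (-(q ^ 2 * (n - 2 : ℕ))) := by gcongr
      _ = Real.exp (2 * L + -(q ^ 2 * (n - 2 : ℕ))) := by
          rw [hnexp, ← Real.exp_nat_mul, Real.exp_add]
          norm_num
      _ ≤ _ := by
        refine Real.exp_le_exp.2 ?_
        rw [Nat.cast_sub hn2]
        push_cast
        have h3 : q ^ 2 * (n / 2) ≤ q ^ 2 * (n - 2) := by gcongr; linarith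
        have h4 : q ^ 2 * (n / 2) = L ^ 4 / 2 := by rw [← mul_div_assoc, hq2]
        have h5 : (r + 3) * L ≤ L * L := by gcongr
        have h6 : (2 : ℝ) * L ^ 2 ≤ L ^ 2 * L ^ 2 := by gcongr; nlinarith
        linarith
  linarith

theorem eventually_large (η : ℝ) (hη : 0 < η) (r : ℝ) : ∀ᶠ n : ℕ in atTop,
    22 ≤ Real.log n ∧ r + 3 ≤ Real.log n ∧ 10 ≤ √(n : ℝ) ∧ r + 1 ≤ √(n : ℝ) ∧
      2 ≤ (n : ℝ) ^ η ∧ (2 * (r + 1)) * Real.log n ≤ (n : ℝ) ^ (2 * η) ∧ 1 ≤ n := by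
  have hcast : Tendsto (fun n : ℕ => (n : ℝ)) atTop atTop := tendsto_natCast_atTop_atTop
  have hlog := Real.tendsto_log_atTop.comp hcast
  have hsqrt := Real.tendsto_sqrt_atTop.comp hcast
  have hpow := (tendsto_rpow_atTop hη).comp hcast
  have hlo := ((isLittleO_log_rpow_atTop (by positivity : 0 < 2 * η)).comp_tendsto hcast).bound
    (c := 1 / (2 * |r + 1| + 1)) (by positivity)
  filter_upwards [hlog.eventually_ge_atTop 22, hlog.eventually_ge_atTop (r + 3),
    hsqrt.eventually_ge_atTop 10, hsqrt.eventually_ge_atTop (r + 1),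
    hpow.eventually_ge_atTop 2, hlo, eventually_ge_atTop 1] with n h1 h2 h3 h4 h5 h6 h7
  refine ⟨h1, h2, h3, h4, h5, ?_, h7⟩
  simp only [Function.comp_apply, Real.norm_eq_abs] at h1 h6
  have hlog0 : 0 ≤ Real.log n := by linarith
  have hpow0 : 0 ≤ (n : ℝ) ^ (2 * η) := by positivity
  rw [abs_of_nonneg hlog0, abs_of_nonneg hpow0, div_mul_eq_mul_div, one_mul,
    le_div_iff₀ (by positivity)] at h6
  refine le_trans ?_ h6
  rw [mul_comm]
  gcongr
  linarith [le_abs_self (r + 1)]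

/-- The deviation of `m / 2` from `n / 4` is at most `l / 4`, which leaves `3 l / 4` for `k`. -/
theorem mem_Icc_of_oddVerts {n k N m : ℕ} {l : ℝ} (h : |(n : ℝ) - 2 * m| ≤ l) (h1 : m ≤ 2 * N)
    (h2 : 2 * N ≤ m + 2 * k) (hk : (k : ℝ) ≤ 3 / 4 * l) :
    (N : ℝ) ∈ Set.Icc ((n : ℝ) / 4 - l) ((n : ℝ) / 4 + l) := by
  have h1' : (m : ℝ) ≤ 2 * N := by exact_mod_cast h1
  have h2' : (2 : ℝ) * N ≤ m + 2 * k := by exact_mod_cast h2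
  have h0 := (abs_nonneg _).trans h
  rw [abs_le] at h
  constructor <;> linarith

end Asymptotics

end SimpleGraph

/-! ### The main theorem -/

open MeasureTheory unitInterval in
theorem theorem1 (η : ℝ) (hη : 0 < η) (r : ℝ) (hr : 0 < r) :
    ∃ n₀ : ℕ, 1 ≤ n₀ ∧ ∀ n : ℕ, n₀ ≤ n → ∀ p : unitInterval,
      (Real.log n) ^ 2 / Real.sqrt n ≤ (p : ℝ) →
      (p : ℝ) ≤ 1 - (Real.log n) ^ 2 / Real.sqrt n →
      1 - 1 / (n : ℝ) ^ r ≤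
        (SimpleGraph.binomialRandom (Fin n) p).real
          {H : SimpleGraph (Fin n) |
            (H.EulerianEditable ∧
              (H.eulerianEditNumber : ℝ) ∈
                Set.Icc ((n : ℝ) / 4 - (n : ℝ) ^ (1 / 2 + η))
                  ((n : ℝ) / 4 + (n : ℝ) ^ (1 / 2 + η))) ∧
            (H.EulerianExtendable ∧
              (H.eulerianExtNumber : ℝ) ∈
                Set.Icc ((n : ℝ) / 4 - (n : ℝ) ^ (1 / 2 + η))
                  ((n : ℝ) / 4 + (n : ℝ) ^ (1 / 2 + η))) ∧
            (H.EulerianReducible ∧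
              (H.eulerianRedNumber : ℝ) ∈
                Set.Icc ((n : ℝ) / 4 - (n : ℝ) ^ (1 / 2 + η))
                  ((n : ℝ) / 4 + (n : ℝ) ^ (1 / 2 + η)))} := by
  obtain ⟨n₀, hn₀⟩ := Filter.eventually_atTop.1 (SimpleGraph.eventually_large η hη r)
  refine ⟨max n₀ 1, le_max_right _ _, fun n hn p hqp hpq => ?_⟩
  obtain ⟨hL, hLr, hs, hsr, hnη, hnlog, hn1⟩ := hn₀ n ((le_max_left _ _).trans hn)
  have hn0 : (0 : ℝ) < n := by exact_mod_cast hn1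
  have hss : √(n : ℝ) ^ 2 = n := Real.sq_sqrt hn0.le
  have hn100 : (100 : ℝ) ≤ n := by nlinarith
  have : Nonempty (Fin n) := ⟨⟨0, hn1⟩⟩
  set l : ℝ := (n : ℝ) ^ (1 / 2 + η) with hl
  have hl0 : 0 ≤ l := by positivity
  have hlval : l = √n * (n : ℝ) ^ η := by rw [hl, Real.rpow_add hn0, ← Real.sqrt_eq_rpow]
  have hlsq : l ^ 2 = n * (n : ℝ) ^ (2 * η) := by
    rw [hlval, mul_pow, hss, mul_comm 2 η, Real.rpow_mul hn0.le, Real.rpow_two]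
  -- As `n ^ η ≥ 2`, the right side is at least `3/2 √n`, which exceeds `√n + 1`.
  have hk : (⌈√(n : ℝ)⌉₊ : ℝ) ≤ 3 / 4 * l := by
    have := (Nat.ceil_lt_add_one (Real.sqrt_nonneg (n : ℝ))).le
    rw [hlval]
    nlinarith
  -- One power of `n` more than required, to absorb the factor `18 = 3 + 3 + 12` of the three
  -- failure bounds.
  set ε := Real.exp (-((r + 1) * Real.log n)) with hε
  have hεn : ε * n = 1 / (n : ℝ) ^ r := by
    have h1 : ε = (n : ℝ) ^ (-(r + 1)) := by
      rw [hε, Real.rpow_def_of_pos hn0]; ring_nf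
    rw [h1, one_div, ← Real.rpow_neg hn0.le]
    nth_rewrite 2 [← Real.rpow_one (n : ℝ)]
    rw [← Real.rpow_add hn0]
    ring_nf
  have hε0 : 0 < ε := Real.exp_pos _
  have b1 : (SimpleGraph.binomialRandom (Fin n) p).real {G | ¬ G.IsRobust ⌈√(n : ℝ)⌉₊} ≤ 3 * ε :=
    SimpleGraph.measureReal_not_isRobust_le_exp hqp hL hLr hs hsr
  have b2 : (SimpleGraph.binomialRandom (Fin n) p).real {G | ¬ Gᶜ.IsRobust ⌈√(n : ℝ)⌉₊} ≤ 3 * ε := by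
    have := SimpleGraph.measureReal_compl_mem (p := p)
      {G : SimpleGraph (Fin n) | ¬ G.IsRobust ⌈√(n : ℝ)⌉₊}
    simp only [Set.mem_ofPred_eq] at this
    rw [this]
    refine SimpleGraph.measureReal_not_isRobust_le_exp ?_ hL hLr hs hsr
    rw [unitInterval.coe_symm_eq]
    linarith
  have b3 : (SimpleGraph.binomialRandom (Fin n) p).real
      {G | l < |(n : ℝ) - 2 * G.oddVerts.card|} ≤ 12 * ε := by
    have hq : Real.log n ^ 2 / √(n : ℝ) * n = Real.log n * (Real.log n * √n) := by
      rw [div_mul_eq_mul_div, div_eq_iff (by positivity)]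
      linear_combination (-Real.log n ^ 2) * hss
    -- The exponent is `(log n)² √n`, which is at least `log n`.
    have hV : (n : ℝ) * Real.exp (-(Real.log n ^ 2 / √(n : ℝ) * n)) ≤ 1 := by
      nth_rewrite 1 [← Real.exp_log hn0]
      rw [← Real.exp_add, Real.exp_le_one_iff, hq]
      nlinarith [mul_le_mul hL hs (by norm_num) (by linarith)]
    have := SimpleGraph.measureReal_oddVerts_deviation_le (V := Fin n) (p := p)
      (by positivity) hqp hpq (by simpa using hV) hl0
    rw [Fintype.card_fin] at this
    refine this.trans ?_
    refine mul_le_mul_of_nonneg_left (Real.exp_le_exp.2 ?_) (by norm_num)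
    rw [hlsq, mul_comm 2 (n : ℝ), mul_div_mul_left _ _ hn0.ne']
    linarith
  have key : ∀ S : Set (SimpleGraph (Fin n)), (∀ G : SimpleGraph (Fin n),
      G.IsRobust ⌈√(n : ℝ)⌉₊ → Gᶜ.IsRobust ⌈√(n : ℝ)⌉₊ →
        |(n : ℝ) - 2 * G.oddVerts.card| ≤ l → G ∈ S) →
      1 - 1 / (n : ℝ) ^ r ≤ (SimpleGraph.binomialRandom (Fin n) p).real S := by
    intro S hS
    have hcover : (Set.univ : Set (SimpleGraph (Fin n))) ⊆ (S ∪
        {G | ¬ G.IsRobust ⌈√(n : ℝ)⌉₊}) ∪ {G | ¬ Gᶜ.IsRobust ⌈√(n : ℝ)⌉₊} ∪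
          {G | l < |(n : ℝ) - 2 * G.oddVerts.card|} := by
      intro G _
      have := hS G
      simp only [Set.mem_union, Set.mem_ofPred_eq, ← not_le]
      tauto
    have h1 := measureReal_mono (μ := SimpleGraph.binomialRandom (Fin n) p) hcover
      (measure_ne_top _ _)
    rw [probReal_univ] at h1
    have h2 := h1.trans ((measureReal_union_le _ _).trans (add_le_add_left
      ((measureReal_union_le _ _).trans (add_le_add_left (measureReal_union_le _ _) _)) _))
    have h3 : 18 * ε ≤ 1 / (n : ℝ) ^ r := by rw [← hεn]; nlinarith
    linarith
  refine key _ fun G h1 h2 h3 => ?_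
  have hcard : 4 ≤ Fintype.card (Fin n) := by
    rw [Fintype.card_fin]
    have : (4 : ℝ) ≤ n := by linarith
    exact_mod_cast this
  obtain ⟨⟨he, he1, he2⟩, ⟨hx, hx1, hx2⟩, ⟨hd, hd1, hd2⟩⟩ := h1.eulerian_numbers hcard h2
  exact ⟨⟨he, SimpleGraph.mem_Icc_of_oddVerts h3 he1 he2 hk⟩,
    ⟨hx, SimpleGraph.mem_Icc_of_oddVerts h3 hx1 hx2 hk⟩,
    ⟨hd, SimpleGraph.mem_Icc_of_oddVerts h3 hd1 hd2 hk⟩⟩
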